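/- Let $\alpha,\lambda>0$ and let $X_1,X_2$ be independent random variables with the gamma density $f(x;\alpha,\lambda)=\frac{1}{\Gamma(\alpha)\lambda^{\alpha}}x^{\alpha-1}e^{-x/\lambda}$, $x>0$. Let $\hat\alpha=\bar X^2/S^2$ be the moment estimator of the shape parameter, where $\bar X=\frac12(X_1+X_2)$ and $S^2=\frac12\sum_{i=1}^2(X_i-\bar X)^2$ are the sample mean and the biased sample variance. Then $\hat\alpha$ is increasing in $\alpha$ with respect to the star order $\le_*$; equivalently, $\log\hat\alpha$ is increasing in $\alpha$ with respect to the dispersive order. That is: let $0<\alpha_1<\alpha_2$, let $\lambda_1,\lambda_2>0$ be arbitrary, and let $\hat\alpha_1$ and $\hat\alpha_2$ be the estimators computed from samples of size $2$ from $f(\cdot;\alpha_1,\lambda_1)$ and $f(\cdot;\alpha_2,\lambda_2)$ respectively, with distribution functions $F$ and $G$. Then $\hat\alpha_1$ and $\hat\alpha_2$ are almost surely nonnegative and $F$, $G$ are continuous and strictly increasing where their values lie in $(0,1)$; the function $x\mapsto G^{-1}(F(x))/x$ is nondecreasing on $\{x: 0<F(x)<1\}$ (that is, $\hat\alpha_1\le_*\hat\alpha_2$),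 where $G^{-1}(p)=\inf\{y: G(y)\ge p\}$; and, writing $q_i$ for the quantile function of $\log\hat\alpha_i$, $q_1(v)-q_1(u)\le q_2(v)-q_2(u)$ for all $0<u\le v<1$ (that is, $\log\hat\alpha_1\le_{\mathrm{disp}}\log\hat\alpha_2$). -/

import Mathlib

open MeasureTheory ProbabilityTheory

noncomputable section

namespace GammaMoment

/-- The sample mean of `x 0, …, x (n - 1)`. -/
def sampleMean {n : ℕ} (x : Fin n → ℝ) : ℝ :=
  (∑ i, x i) / n

/-- The biased sample variance, with the factor `1 / n`. -/
def sampleVar {n : ℕ} (x : Fin n → ℝ) : ℝ :=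
  (∑ i, (x i - sampleMean x) ^ 2) / n

/-- The moment estimator of the shape parameter: squared sample mean over biased sample variance.
For the samples considered below the denominator is almost surely nonzero. -/
def alphaHat {n : ℕ} (x : Fin n → ℝ) : ℝ :=
  sampleMean x ^ 2 / sampleVar x

/-- `X` is a random sample (independent, identically distributed observations) from the gamma
distribution with shape `α` and scale `lam`, whose density on the positive half-line is
`x ^ (α - 1) * exp (-x / lam) / (Γ(α) * lam ^ α)`. The gamma measure of Mathlib has the rate
as its second parameter, hence the inverse. -/
structure IsGammaSample {Ω : Type*} [MeasurableSpace Ω] {n : ℕ} (X : Fin n → Ω → ℝ)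
    (α lam : ℝ) (P : Measure Ω) : Prop where
  indep : iIndepFun X P
  law : ∀ i, HasLaw (X i) (gammaMeasure α lam⁻¹) P

/-- The quantile function (left-continuous inverse of the distribution function),
to be used for `0 < p < 1`, where the set is nonempty and bounded below. -/
def quantile (μ : Measure ℝ) (p : ℝ) : ℝ :=
  sInf {x : ℝ | p ≤ cdf μ x}

/-- The dispersive order of two laws on the real line: every interquantile distance of `μ` is at
most the corresponding interquantile distance of `ν`. -/
def DispLE (μ ν : Measure ℝ) : Prop :=
  ∀ p q : ℝ, 0 < p → p ≤ q → q < 1 →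
    quantile μ q - quantile μ p ≤ quantile ν q - quantile ν p

/-- The laws between which the star order is considered: laws of nonnegative random variables with
a continuous distribution function and an interval as support. -/
structure IsNonnegContinuousLaw (μ : Measure ℝ) : Prop where
  nonneg : μ (Set.Iio 0) = 0
  continuous_cdf : Continuous (cdf μ)
  strictMonoOn_cdf : StrictMonoOn (cdf μ) {x | 0 < cdf μ x ∧ cdf μ x < 1}

/-- The star order: with `F`, `G` the distribution functions of `μ`, `ν`, the function
`G⁻¹(F(x)) / x` is increasing on the (interior of the) support of `F`. -/
structure StarLE (μ ν : Measure ℝ) : Prop where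
  left : IsNonnegContinuousLaw μ
  right : IsNonnegContinuousLaw ν
  mono : MonotoneOn (fun x => quantile ν (cdf μ x) / x) {x | 0 < cdf μ x ∧ cdf μ x < 1}

end GammaMoment

end

/-! For two observations the estimator is `(x + y) ^ 2 / (x - y) ^ 2`, a function of the ratio `r =
x / y`, so the scale drops out. Integrating the density of `r` over the set where the estimator
exceeds `t`, then differentiating in `t`, gives the density `c * (1 - 1 / t) ^ (a - 1) * t ^ (-3 /
2)` on `t > 1`: the reciprocal of the estimator is Beta(1/2, a). `HasMomentCdf` records this, and
the comparison of shapes uses nothing else.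

The star order is a crossing property: for each `m`, `F x - G (m * x)` must not pass from positive
to negative. Only `m ≥ 1` matters, because `G ≤ F` (`le_of_lt`) gives `G⁻¹(F x) ≥ x`. The powers of
`x` cancel in the ratio of the densities of `F x` and `G (m * x)`, and the derivative of the
log-ratio has the sign of an affine function that is positive at 0. Hence the log-ratio has no dip
(`logRatio_not_dip`), whereas a forbidden crossing would make the difference rise, fall and rise
again (`sub_nonneg_of_pos`). The dispersive order of the logarithms is the logarithm of the same
inequality (`div_le_div`). -/

namespace GammaMoment

open Set Filter Topology

/-- The properties of the distribution function of the moment estimator of the shape `a` from a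
gamma sample of size two on which the comparison of different shapes rests. -/
structure HasMomentCdf (F : ℝ → ℝ) (a : ℝ) : Prop where
  continuous : Continuous F
  eq_zero : ∀ x ≤ 1, F x = 0
  tendsto_atTop : Tendsto F atTop (𝓝 1)
  exists_hasDerivAt : ∃ c > 0, ∀ x > 1,
    HasDerivAt F (c * (1 - 1 / x) ^ (a - 1) * x ^ (-(3 / 2) : ℝ)) x

lemma one_sub_one_div_pos {x : ℝ} (hx : 1 < x) : 0 < 1 - 1 / x := by
  have : 1 / x < 1 := by rw [div_lt_one (by linarith)]; exact hx
  linarith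

/-! ### Monotonicity and inversion of the distribution function. -/

namespace HasMomentCdf

variable {F G : ℝ → ℝ} {a b : ℝ}

lemma strictMonoOn (hF : HasMomentCdf F a) : StrictMonoOn F (Ici 1) := by
  obtain ⟨c, hc, hd⟩ := hF.exists_hasDerivAt
  refine strictMonoOn_of_deriv_pos (convex_Ici 1) hF.continuous.continuousOn fun x hx => ?_
  rw [interior_Ici] at hx
  have hx1 : 1 < x := hx
  rw [(hd x hx1).deriv]
  have := one_sub_one_div_pos hx1
  positivity

lemma monotone (hF : HasMomentCdf F a) : Monotone F := by
  intro x y hxy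
  rcases le_total x 1 with hx | hx
  · rcases le_total y 1 with hy | hy
    · rw [hF.eq_zero x hx, hF.eq_zero y hy]
    · rw [hF.eq_zero x hx, ← hF.eq_zero 1 le_rfl]
      exact hF.strictMonoOn.monotoneOn self_mem_Ici hy hy
  · exact hF.strictMonoOn.monotoneOn hx (hx.trans hxy) hxy

lemma nonneg (hF : HasMomentCdf F a) (x : ℝ) : 0 ≤ F x := by
  rw [← hF.eq_zero (min x 1) (min_le_right _ _)]
  exact hF.monotone (min_le_left _ _)

lemma one_lt_of_pos (hF : HasMomentCdf F a) {x : ℝ} (hx : 0 < F x) : 1 < x := by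
  by_contra h
  exact hx.ne' (hF.eq_zero x (not_lt.1 h))

lemma exists_eq (hF : HasMomentCdf F a) {p : ℝ} (hp0 : 0 < p) (hp1 : p < 1) :
    ∃ x, 1 < x ∧ F x = p := by
  obtain ⟨M, hM⟩ := (hF.tendsto_atTop.eventually (lt_mem_nhds hp1)).exists
  have h0 : F 1 = 0 := hF.eq_zero 1 le_rfl
  have hM1 : 1 ≤ M := (hF.one_lt_of_pos (hp0.trans hM)).le
  obtain ⟨x, -, hx⟩ := intermediate_value_Icc hM1 hF.continuous.continuousOn
    (show p ∈ Icc (F 1) (F M) from ⟨h0 ▸ hp0.le, hM.le⟩)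
  exact ⟨x, hF.one_lt_of_pos (hx ▸ hp0), hx⟩

lemma le_iff_le (hF : HasMomentCdf F a) {x y : ℝ} (hx : 1 < x) : F x ≤ F y ↔ x ≤ y := by
  refine ⟨fun h => ?_, fun h => hF.monotone h⟩
  have h0 : F 1 = 0 := hF.eq_zero 1 le_rfl
  have hpos : 0 < F x := h0 ▸ hF.strictMonoOn self_mem_Ici hx.le hx
  exact (hF.strictMonoOn.le_iff_le hx.le (hF.one_lt_of_pos (hpos.trans_le h)).le).1 h

/-! ### Shape of the log-ratio of the densities. -/

/-- Up to an additive constant, the logarithm of the ratio of the density for the shape `a` at `x`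
to the density for the shape `b` at `m * x`. -/
noncomputable def logRatio (a b m x : ℝ) : ℝ :=
  (a - 1) * Real.log (1 - 1 / x) - (b - 1) * Real.log (1 - 1 / (m * x))

/-- In this form the denominator is positive for `x > 1`, and the numerator is affine in `x` with
value `b - a` at 0, so the sign can be read off. -/
lemma hasDerivAt_logRatio {m x : ℝ} (hm : 1 ≤ m) (hx : 1 < x) :
    HasDerivAt (logRatio a b m)
      ((((a - 1) * m - (b - 1)) * x + (b - a)) / (x * (x - 1) * (m * x - 1))) x := by
  have hx0 : x ≠ 0 := by positivity
  have hm0 : m ≠ 0 := by positivity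
  have hmx : 1 < m * x := by nlinarith
  have h1 := one_sub_one_div_pos hx
  have h2 := one_sub_one_div_pos hmx
  have d1 : HasDerivAt (fun x : ℝ => 1 - 1 / x) (1 / x ^ 2) x := by
    have := ((hasDerivAt_inv hx0).const_sub 1)
    simpa [one_div] using this
  have d2 : HasDerivAt (fun x : ℝ => 1 - 1 / (m * x)) (m / (m * x) ^ 2) x := by
    simp only [one_div]
    refine ((((hasDerivAt_id x).const_mul m).inv (mul_ne_zero hm0 hx0)).const_sub 1).congr_deriv ?_
    simp only [id]
    ring
  have := ((d1.log h1.ne').const_mul (a - 1)).sub ((d2.log h2.ne').const_mul (b - 1))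
  refine this.congr_deriv ?_
  have e1 : x - 1 ≠ 0 := by linarith
  have e2 : m * x - 1 ≠ 0 := by linarith
  have e3 : 1 - 1 / x = (x - 1) / x := by field_simp
  have e4 : 1 - 1 / (m * x) = (m * x - 1) / (m * x) := by field_simp
  rw [e3, e4]
  have e5 : x * m - 1 ≠ 0 := by rwa [mul_comm]
  field_simp
  ring

lemma exists_slope_logRatio {m x y : ℝ} (hm : 1 ≤ m) (hx : 1 < x) (hxy : x < y) :
    ∃ z ∈ Ioo x y, (((a - 1) * m - (b - 1)) * z + (b - a)) / (z * (z - 1) * (m * z - 1)) =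
      (logRatio a b m y - logRatio a b m x) / (y - x) :=
  exists_hasDerivAt_eq_slope (logRatio a b m)
    (fun z => (((a - 1) * m - (b - 1)) * z + (b - a)) / (z * (z - 1) * (m * z - 1))) hxy
    (fun _ hz => (hasDerivAt_logRatio hm (hx.trans_le hz.1)).continuousAt.continuousWithinAt)
    (fun _ hz => hasDerivAt_logRatio hm (hx.trans hz.1))

lemma denom_pos {m x : ℝ} (hm : 1 ≤ m) (hx : 1 < x) : 0 < x * (x - 1) * (m * x - 1) := by
  have : 0 < m * x - 1 := by nlinarith
  have : 0 < x - 1 := by linarith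
  positivity

/-- The log-ratio of the densities is quasiconcave. -/
lemma logRatio_not_dip (hab : a < b) {m x y z : ℝ} (hm : 1 ≤ m) (hx : 1 < x) (hxy : x < y)
    (hyz : y < z) (h₁ : logRatio a b m y < logRatio a b m x) :
    logRatio a b m z ≤ logRatio a b m y := by
  by_contra! h₂
  obtain ⟨u, hu, hu'⟩ := exists_slope_logRatio (a := a) (b := b) hm hx hxy
  obtain ⟨v, hv, hv'⟩ := exists_slope_logRatio (a := a) (b := b) hm (hx.trans hxy) hyz
  have hun : (((a - 1) * m - (b - 1)) * u + (b - a)) / (u * (u - 1) * (m * u - 1)) < 0 := by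
    rw [hu']; exact div_neg_of_neg_of_pos (by linarith) (by linarith)
  have hvp : 0 < (((a - 1) * m - (b - 1)) * v + (b - a)) / (v * (v - 1) * (m * v - 1)) := by
    rw [hv']; exact div_pos (by linarith) (by linarith)
  have hu1 : 1 < u := hx.trans hu.1
  have huv : u < v := hu.2.trans hv.1
  rw [div_lt_iff₀ (denom_pos hm hu1), zero_mul] at hun
  rw [lt_div_iff₀ (denom_pos hm (hu1.trans huv)), zero_mul] at hvp
  -- The affine numerator is positive at 0 and negative at `u`, hence decreasing, and cannot be
  -- positive at `v > u`.
  have : (a - 1) * m - (b - 1) < 0 := by nlinarith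
  nlinarith

/-- For `m = 1` the numerator is `-(b - a) * (x - 1)`, negative throughout. -/
lemma logRatio_one_lt (hab : a < b) {x y : ℝ} (hx : 1 < x) (hxy : x < y) :
    logRatio a b 1 y < logRatio a b 1 x := by
  obtain ⟨u, hu, hu'⟩ := exists_slope_logRatio (a := a) (b := b) le_rfl hx hxy
  have hu1 : 1 < u := hx.trans hu.1
  have hun : (((a - 1) * 1 - (b - 1)) * u + (b - a)) / (u * (u - 1) * (1 * u - 1)) < 0 :=
    div_neg_of_neg_of_pos (by nlinarith) (denom_pos le_rfl hu1)
  rw [hu', div_lt_iff₀ (by linarith)] at hun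
  linarith

/-! ### Crossings of `F x` and `G (m * x)`. -/

/-- The derivative of `x ↦ F x - G (m * x)` has the sign of the log-ratio of the densities minus a
constant. -/
lemma exists_hasDerivAt_sub (hF : HasMomentCdf F a) (hG : HasMomentCdf G b) {m : ℝ} (hm : 1 ≤ m) :
    ∃ (k : ℝ) (d : ℝ → ℝ), (∀ x > 1, HasDerivAt (fun x => F x - G (m * x)) (d x) x) ∧
      (∀ x > 1, 0 < d x → k < logRatio a b m x) ∧ ∀ x > 1, d x < 0 → logRatio a b m x < k := by
  obtain ⟨c, hc, hFd⟩ := hF.exists_hasDerivAt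
  obtain ⟨c', hc', hGd⟩ := hG.exists_hasDerivAt
  have hm0 : 0 < m := by linarith
  have key : ∀ x > 1, 0 < m * x ∧ 0 < 1 - 1 / x ∧ 0 < 1 - 1 / (m * x) ∧
      Real.log (c * (1 - 1 / x) ^ (a - 1) * x ^ (-(3 / 2) : ℝ)) -
        Real.log (c' * (1 - 1 / (m * x)) ^ (b - 1) * (m * x) ^ (-(3 / 2) : ℝ) * m) =
      logRatio a b m x - (Real.log c' - Real.log c - Real.log m / 2) := by
    intro x hx
    have hx : 1 < x := hx
    have hx0 : 0 < x := by linarith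
    have h1 := one_sub_one_div_pos hx
    have h2 := one_sub_one_div_pos (show 1 < m * x by nlinarith)
    refine ⟨by positivity, h1, h2, ?_⟩
    have p1 := (Real.rpow_pos_of_pos h1 (a - 1)).ne'
    have p2 := (Real.rpow_pos_of_pos h2 (b - 1)).ne'
    have p3 := (Real.rpow_pos_of_pos hx0 (-(3 / 2))).ne'
    have p4 := (Real.rpow_pos_of_pos (mul_pos hm0 hx0) (-(3 / 2))).ne'
    rw [Real.log_mul (mul_ne_zero hc.ne' p1) p3, Real.log_mul hc.ne' p1,
      Real.log_mul (mul_ne_zero (mul_ne_zero hc'.ne' p2) p4) hm0.ne',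
      Real.log_mul (mul_ne_zero hc'.ne' p2) p4, Real.log_mul hc'.ne' p2, Real.log_rpow h1,
      Real.log_rpow h2, Real.log_rpow hx0, Real.log_rpow (mul_pos hm0 hx0),
      Real.log_mul hm0.ne' hx0.ne', logRatio]
    ring
  -- The term `log m / 2` comes from `m ^ (-3 / 2)` times the inner derivative `m`.
  refine ⟨Real.log c' - Real.log c - Real.log m / 2,
    fun x => c * (1 - 1 / x) ^ (a - 1) * x ^ (-(3 / 2) : ℝ) -
      c' * (1 - 1 / (m * x)) ^ (b - 1) * (m * x) ^ (-(3 / 2) : ℝ) * m, ?_, ?_, ?_⟩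
  · intro x hx
    have hx : 1 < x := hx
    have h := (hGd (m * x) (show 1 < m * x by nlinarith)).comp x
      ((hasDerivAt_id x).const_mul m)
    refine ((hFd x hx).sub h).congr_deriv ?_
    rw [mul_one]
  · intro x hx hd
    obtain ⟨h0, h1, h2, h⟩ := key x hx
    have hx0 : 0 < x := lt_trans one_pos hx
    have := Real.log_lt_log (by positivity) (sub_pos.1 hd)
    linarith
  · intro x hx hd
    obtain ⟨h0, h1, h2, h⟩ := key x hx
    have hx0 : 0 < x := lt_trans one_pos hx
    have := Real.log_lt_log (by positivity) (sub_neg.1 hd)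
    linarith

lemma tendsto_sub (hF : HasMomentCdf F a) (hG : HasMomentCdf G b) {m : ℝ} (hm : 1 ≤ m) :
    Tendsto (fun x => F x - G (m * x)) atTop (𝓝 0) := by
  have := hF.tendsto_atTop.sub
    (hG.tendsto_atTop.comp (tendsto_id.const_mul_atTop (show 0 < m by linarith)))
  simpa [Function.comp_def] using this

/-- The difference of the distribution functions, one of them rescaled, cannot change its sign
from positive to negative. -/
lemma sub_nonneg_of_pos (hF : HasMomentCdf F a) (hG : HasMomentCdf G b) (hab : a < b)
    {m x y : ℝ} (hm : 1 ≤ m) (hx : 1 < x) (hxy : x < y) (h : 0 < F x - G (m * x)) :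
    0 ≤ F y - G (m * y) := by
  by_contra! hy
  obtain ⟨k, d, hd, hpos, hneg⟩ := hF.exists_hasDerivAt_sub hG hm
  have hc : Continuous fun x => F x - G (m * x) :=
    hF.continuous.sub (hG.continuous.comp (continuous_const.mul continuous_id))
  -- The difference is nonpositive at 1, positive at `x`, negative at `y` and tends to 0, so it is
  -- larger at some `z > y` than at `y`. Its derivative is thus positive, negative, positive at some
  -- `u < v < w`, which puts a dip in the log-ratio.
  obtain ⟨z, hyz, hz⟩ := ((eventually_gt_atTop y).and
    ((hF.tendsto_sub hG hm).eventually (lt_mem_nhds hy))).exists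
  obtain ⟨u, hu, hu'⟩ := exists_hasDerivAt_eq_slope _ d hx hc.continuousOn
    fun w hw => hd w hw.1
  obtain ⟨v, hv, hv'⟩ := exists_hasDerivAt_eq_slope _ d hxy hc.continuousOn
    fun w hw => hd w (hx.trans hw.1)
  obtain ⟨w, hw, hw'⟩ := exists_hasDerivAt_eq_slope _ d hyz hc.continuousOn
    fun w hw => hd w ((hx.trans hxy).trans hw.1)
  have hu0 : 0 < d u := by
    have h1 := hF.eq_zero 1 le_rfl
    have h2 := hG.nonneg (m * 1)
    rw [hu']; exact div_pos (by linarith) (by linarith)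
  have hv0 : d v < 0 := by
    rw [hv']; exact div_neg_of_neg_of_pos (by linarith) (by linarith)
  have hw0 : 0 < d w := by
    rw [hw']; exact div_pos (by linarith) (by linarith)
  have hv1 : 1 < v := hx.trans hv.1
  have hw1 : 1 < w := (hx.trans hxy).trans hw.1
  have := logRatio_not_dip hab hm hu.1 (hu.2.trans hv.1) (hv.2.trans hw.1)
    ((hneg v hv1 hv0).trans (hpos u hu.1 hu0))
  linarith [hneg v hv1 hv0, hpos w hw1 hw0]

/-- The moment estimator is stochastically increasing in the shape. -/
lemma le_of_lt (hF : HasMomentCdf F a) (hG : HasMomentCdf G b) (hab : a < b) (x : ℝ) :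
    G x ≤ F x := by
  rcases le_or_gt x 1 with hx | hx
  · rw [hF.eq_zero x hx, hG.eq_zero x hx]
  by_contra! hlt
  have hy : F x - G (1 * x) < 0 := by rw [one_mul]; linarith
  obtain ⟨k, d, hd, hpos, hneg⟩ := hF.exists_hasDerivAt_sub hG le_rfl
  have hc : Continuous fun x => F x - G (1 * x) :=
    hF.continuous.sub (hG.continuous.comp (continuous_const.mul continuous_id))
  -- The difference is 0 at 1, negative at `x` and larger at `z`: it falls and then rises, against
  -- the strict decrease of the log-ratio.
  obtain ⟨z, hxz, hz⟩ := ((eventually_gt_atTop x).and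
    ((hF.tendsto_sub hG le_rfl).eventually (lt_mem_nhds hy))).exists
  obtain ⟨u, hu, hu'⟩ := exists_hasDerivAt_eq_slope _ d hx hc.continuousOn
    fun w hw => hd w hw.1
  obtain ⟨v, hv, hv'⟩ := exists_hasDerivAt_eq_slope _ d hxz hc.continuousOn
    fun w hw => hd w (hx.trans hw.1)
  have hu0 : d u < 0 := by
    have h1 := hF.eq_zero 1 le_rfl
    have h2 := hG.eq_zero (1 * 1) (by norm_num)
    rw [hu']; exact div_neg_of_neg_of_pos (by linarith) (by linarith)
  have hv0 : 0 < d v := by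
    rw [hv']; exact div_pos (by linarith) (by linarith)
  have hv1 : 1 < v := hx.trans hv.1
  linarith [hneg u hu.1 hu0, hpos v hv1 hv0, logRatio_one_lt hab hu.1 (hu.2.trans hv.1)]

/-- If `G x' = F x` and `G y' = F y` with `x ≤ y`, then `x' / x ≤ y' / y`. -/
lemma div_le_div (hF : HasMomentCdf F a) (hG : HasMomentCdf G b) (hab : a < b)
    {x y x' y' : ℝ} (hx : 1 < x) (hxy : x ≤ y) (hx' : 1 < x') (hy' : 1 < y')
    (hxx' : G x' = F x) (hyy' : G y' = F y) : x' / x ≤ y' / y := by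
  by_contra! hlt
  have hxy : x < y := by
    refine lt_of_le_of_ne hxy ?_
    rintro rfl
    rw [← hyy'] at hxx'
    have := hG.strictMonoOn.injOn (show x' ∈ Ici (1 : ℝ) from hx'.le)
      (show y' ∈ Ici (1 : ℝ) from hy'.le) hxx'
    subst this
    exact lt_irrefl _ hlt
  have hy : 1 < y := hx.trans hxy
  have hyy : y ≤ y' := by
    rw [← hG.le_iff_le hy, hyy']
    exact hF.le_of_lt hG hab y
  -- A scale `m` strictly between the two quotients yields `G (m * x) < F x` and `F y < G (m * y)`,
  -- the forbidden crossing.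
  obtain ⟨m, hm₁, hm₂⟩ := exists_between hlt
  have hm : 1 ≤ m := ((one_le_div (by linarith)).2 hyy).trans hm₁.le
  rw [lt_div_iff₀ (by linarith)] at hm₂
  rw [div_lt_iff₀ (by linarith)] at hm₁
  have h1 : G (m * x) < G x' := hG.strictMonoOn (show 1 ≤ m * x by nlinarith) hx'.le hm₂
  have h2 : G y' < G (m * y) := hG.strictMonoOn hy'.le (show 1 ≤ m * y by nlinarith) hm₁
  have := hF.sub_nonneg_of_pos hG hab hm hx hxy (by linarith)
  linarith

end HasMomentCdf

/-! ### From distribution functions to the star and dispersive orders. -/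

lemma quantile_eq {μ : Measure ℝ} {a x : ℝ} (h : HasMomentCdf (cdf μ) a) (hx : 1 < x) :
    quantile μ (cdf μ x) = x := by
  have : {y : ℝ | cdf μ x ≤ cdf μ y} = Ici x := by
    ext y
    exact h.le_iff_le hx
  rw [quantile, this, csInf_Ici]

lemma measure_Iic_one_eq_zero {μ : Measure ℝ} [IsProbabilityMeasure μ] {a : ℝ}
    (h : HasMomentCdf (cdf μ) a) : μ (Iic 1) = 0 := by
  rw [← ofReal_cdf, h.eq_zero 1 le_rfl, ENNReal.ofReal_zero]

lemma isNonnegContinuousLaw {μ : Measure ℝ} [IsProbabilityMeasure μ] {a : ℝ}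
    (h : HasMomentCdf (cdf μ) a) : IsNonnegContinuousLaw μ where
  nonneg := measure_mono_null (fun _ hx => mem_Iic.2 ((le_of_lt (mem_Iio.1 hx)).trans zero_le_one))
    (measure_Iic_one_eq_zero h)
  continuous_cdf := h.continuous
  strictMonoOn_cdf := h.strictMonoOn.mono fun _ hx => (h.one_lt_of_pos hx.1).le

lemma cdf_map_log {μ : Measure ℝ} [IsProbabilityMeasure μ] {a : ℝ}
    (h : HasMomentCdf (cdf μ) a) (t : ℝ) : cdf (μ.map Real.log) t = cdf μ (Real.exp t) := by
  have : IsProbabilityMeasure (μ.map Real.log) :=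
    Measure.isProbabilityMeasure_map Real.measurable_log.aemeasurable
  rw [cdf_eq_real, cdf_eq_real, map_measureReal_apply Real.measurable_log measurableSet_Iic]
  refine measureReal_congr ?_
  -- `Real.log x ≤ t ↔ x ≤ Real.exp t` can fail for negative `x`, where `Real.log` takes the value
  -- at `|x|`.
  have h1 : ∀ᵐ x ∂μ, 1 < x := by
    rw [ae_iff]
    simp only [not_lt]
    exact measure_Iic_one_eq_zero h
  filter_upwards [h1] with x hx
  exact propext (Real.log_le_iff_le_exp (by linarith))

lemma quantile_map_log {μ : Measure ℝ} [IsProbabilityMeasure μ] {a x : ℝ}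
    (h : HasMomentCdf (cdf μ) a) (hx : 1 < x) :
    quantile (μ.map Real.log) (cdf μ x) = Real.log x := by
  have : {t : ℝ | cdf μ x ≤ cdf (μ.map Real.log) t} = Ici (Real.log x) := by
    ext t
    rw [mem_ofPred_eq, cdf_map_log h, h.le_iff_le hx, mem_Ici,
      Real.log_le_iff_le_exp (by linarith)]
  rw [quantile, this, csInf_Ici]

lemma starLE_of_hasMomentCdf {μ ν : Measure ℝ} [IsProbabilityMeasure μ] [IsProbabilityMeasure ν]
    {a b : ℝ} (hμ : HasMomentCdf (cdf μ) a) (hν : HasMomentCdf (cdf ν) b) (hab : a < b) :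
    StarLE μ ν where
  left := isNonnegContinuousLaw hμ
  right := isNonnegContinuousLaw hν
  mono := by
    rintro x ⟨hx0, hx1⟩ y ⟨hy0, hy1⟩ hxy
    obtain ⟨x', hx', hxx'⟩ := hν.exists_eq hx0 hx1
    obtain ⟨y', hy', hyy'⟩ := hν.exists_eq hy0 hy1
    simp only [← hxx', ← hyy', quantile_eq hν hx', quantile_eq hν hy']
    exact hμ.div_le_div hν hab (hμ.one_lt_of_pos hx0) hxy hx' hy' hxx' hyy'

lemma dispLE_map_log_of_hasMomentCdf {μ ν : Measure ℝ} [IsProbabilityMeasure μ]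
    [IsProbabilityMeasure ν] {a b : ℝ} (hμ : HasMomentCdf (cdf μ) a)
    (hν : HasMomentCdf (cdf ν) b) (hab : a < b) :
    DispLE (μ.map Real.log) (ν.map Real.log) := by
  intro p q hp hpq hq
  obtain ⟨x, hx, hxp⟩ := hμ.exists_eq hp (hpq.trans_lt hq)
  obtain ⟨y, hy, hyq⟩ := hμ.exists_eq (hp.trans_le hpq) hq
  obtain ⟨x', hx', hxp'⟩ := hν.exists_eq hp (hpq.trans_lt hq)
  obtain ⟨y', hy', hyq'⟩ := hν.exists_eq (hp.trans_le hpq) hq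
  have e1 := quantile_map_log hμ hx
  have e2 := quantile_map_log hμ hy
  have e3 := quantile_map_log hν hx'
  have e4 := quantile_map_log hν hy'
  rw [hxp] at e1
  rw [hyq] at e2
  rw [hxp'] at e3
  rw [hyq'] at e4
  rw [e1, e2, e3, e4]
  have hxy : x ≤ y := by rw [← hμ.le_iff_le hx, hxp, hyq]; exact hpq
  have h := hμ.div_le_div hν hab hx hxy hx' hy' (hxp'.trans hxp.symm) (hyq'.trans hyq.symm)
  have hl := Real.log_le_log (by positivity) h
  rw [Real.log_div (by positivity) (by positivity), Real.log_div (by positivity) (by positivity)]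
    at hl
  linarith

/-! ### Law of the ratio of two gamma variables. -/

/-- The unnormalized density of the ratio of two independent gamma variables of shape `a`. -/
noncomputable def ratioKernel (a r : ℝ) : ℝ :=
  r ^ (a - 1) * (1 + r) ^ (-(2 * a))

lemma lintegral_eq_mul_lintegral_comp_mul_left {f : ℝ → ENNReal} (hf : Measurable f) {y : ℝ}
    (hy : y ≠ 0) : ∫⁻ x, f x = ENNReal.ofReal |y| * ∫⁻ r, f (y * r) := by
  conv_lhs => rw [← Real.smul_map_volume_mul_left hy]
  rw [lintegral_smul_measure, lintegral_map hf (measurable_const_mul y), smul_eq_mul]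

/-- The left side is the joint density after `x = y * r`, with Jacobian `y`. As a function of `y` it
is a multiple of a gamma density, so `y` integrates out and the rate `b` disappears. -/
lemma gammaPDFReal_mul_gammaPDFReal {a b r y : ℝ} (ha : 0 < a) (hb : 0 < b) (hr : 0 < r)
    (hy : 0 < y) :
    gammaPDFReal a b y * (y * gammaPDFReal a b (y * r)) =
      Real.Gamma (2 * a) / Real.Gamma a ^ 2 * ratioKernel a r *
        gammaPDFReal (2 * a) (b * (1 + r)) y := by
  have hyr : 0 < y * r := mul_pos hy hr
  have h1r : 0 < 1 + r := by linarith
  have hG := Real.Gamma_pos_of_pos ha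
  have hG2 := Real.Gamma_pos_of_pos (show 0 < 2 * a by linarith)
  simp only [gammaPDFReal, if_pos hy.le, if_pos hyr.le, ratioKernel]
  rw [Real.mul_rpow hy.le hr.le, Real.mul_rpow hb.le h1r.le, Real.rpow_neg h1r.le,
    show b ^ (2 * a) = b ^ a * b ^ a by rw [← Real.rpow_add hb]; ring_nf,
    show y ^ (2 * a - 1) = y ^ (a - 1) * y ^ (a - 1) * y by
      rw [← Real.rpow_add hy, ← Real.rpow_add_one hy.ne']; ring_nf,
    show Real.exp (-(b * (1 + r) * y)) = Real.exp (-(b * y)) * Real.exp (-(b * (y * r))) by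
      rw [← Real.exp_add]; ring_nf]
  have := (Real.rpow_pos_of_pos h1r (2 * a)).ne'
  field_simp

/-- Taking roots, the condition is `√t * |x - y| < x + y`. The case `x = y` is excluded because
division by zero makes the quotient 0 there. -/
lemma lt_sq_div_sq_iff {t x y : ℝ} (ht : 1 < t) (hx : 0 < x) (hy : 0 < y) (hxy : x ≠ y) :
    t < (x + y) ^ 2 / (x - y) ^ 2 ↔
      y * ((√t - 1) / (√t + 1)) < x ∧ x < y * ((√t + 1) / (√t - 1)) := by
  have hs : 1 < √t := by rw [Real.lt_sqrt zero_le_one]; simpa using ht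
  have hst : t = √t ^ 2 := (Real.sq_sqrt (by linarith)).symm
  generalize √t = s at hs hst
  have h1 : 0 < s - 1 := by linarith
  have h2 : 0 < s + 1 := by linarith
  rw [lt_div_iff₀ (sq_pos_of_ne_zero (sub_ne_zero.2 hxy)), hst, ← mul_pow, sq_lt_sq,
    abs_of_pos (show 0 < x + y by linarith), abs_lt, mul_div_assoc', mul_div_assoc',
    div_lt_iff₀ h2, lt_div_iff₀ h1]
  constructor
  · rintro ⟨h, h'⟩; constructor <;> nlinarith
  · rintro ⟨h, h'⟩; constructor <;> nlinarith

lemma sq_div_sq_zero_right_le {t x : ℝ} (ht : 1 ≤ t) : (0 + x) ^ 2 / (0 - x) ^ 2 ≤ t := by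
  rw [zero_add, zero_sub, neg_sq]
  exact (div_self_le_one _).trans ht

lemma setLIntegral_gammaPDF_eq {a b t y : ℝ} (ht : 1 < t) (hy : 0 < y) :
    ∫⁻ x in {x | t < (x + y) ^ 2 / (x - y) ^ 2}, gammaPDF a b x =
      ENNReal.ofReal y *
        ∫⁻ r in Ioo ((√t - 1) / (√t + 1)) ((√t + 1) / (√t - 1)), gammaPDF a b (y * r) := by
  have hs : 1 < √t := by rw [Real.lt_sqrt zero_le_one]; simpa using ht
  have h1 : 0 < √t - 1 := by linarith
  have hm : Measurable (gammaPDF a b) := (measurable_gammaPDFReal a b).ennreal_ofReal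
  have hA : MeasurableSet {x | t < (x + y) ^ 2 / (x - y) ^ 2} :=
    measurableSet_lt measurable_const (by fun_prop)
  rw [← lintegral_indicator hA, ← lintegral_indicator measurableSet_Ioo]
  have hne : ∀ᵐ x : ℝ, x ≠ y := by simp [ae_iff]
  have hcongr : ∫⁻ x, indicator {x | t < (x + y) ^ 2 / (x - y) ^ 2} (gammaPDF a b) x =
      ∫⁻ x, indicator (Ioo (y * ((√t - 1) / (√t + 1))) (y * ((√t + 1) / (√t - 1))))
        (gammaPDF a b) x := by
    refine lintegral_congr_ae ?_
    filter_upwards [hne] with x hx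
    rcases lt_trichotomy x 0 with h | h | h
    · simp [indicator, gammaPDF_of_neg h]
    · subst h
      have hlo : 0 < y * ((√t - 1) / (√t + 1)) := by positivity
      rw [indicator_of_notMem, indicator_of_notMem]
      · exact fun h => lt_asymm h.1 hlo
      · exact fun h => (sq_div_sq_zero_right_le ht.le).not_gt h
    · simp only [indicator, mem_ofPred_eq, mem_Ioo, lt_sq_div_sq_iff ht h hy hx]
  rw [hcongr, lintegral_eq_mul_lintegral_comp_mul_left (hm.indicator measurableSet_Ioo) hy.ne',
    abs_of_pos hy]
  congr 1
  refine lintegral_congr fun r => ?_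
  simp only [indicator, mem_Ioo, mul_lt_mul_iff_right₀ hy]

lemma prod_gammaMeasure_setOf_lt {a b t : ℝ} (ha : 0 < a) (hb : 0 < b) (ht : 1 < t) :
    (gammaMeasure a b).prod (gammaMeasure a b) {p | t < (p.1 + p.2) ^ 2 / (p.1 - p.2) ^ 2} =
      ∫⁻ r in Ioo ((√t - 1) / (√t + 1)) ((√t + 1) / (√t - 1)),
        ENNReal.ofReal (Real.Gamma (2 * a) / Real.Gamma a ^ 2 * ratioKernel a r) := by
  have hs : 1 < √t := by rw [Real.lt_sqrt zero_le_one]; simpa using ht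
  have h1 : 0 < √t - 1 := by linarith
  have := isProbabilityMeasure_gammaMeasure ha hb
  have hm : Measurable (gammaPDF a b) := (measurable_gammaPDFReal a b).ennreal_ofReal
  have hA : MeasurableSet {p : ℝ × ℝ | t < (p.1 + p.2) ^ 2 / (p.1 - p.2) ^ 2} :=
    measurableSet_lt measurable_const (by fun_prop)
  have hne : ∀ᵐ y : ℝ, y ≠ 0 := by simp [ae_iff]
  have hslice : ∀ y : ℝ, MeasurableSet {x : ℝ | t < (x + y) ^ 2 / (x - y) ^ 2} := fun y =>
    measurableSet_lt measurable_const (by fun_prop)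
  have hinner : Measurable fun y : ℝ =>
      gammaMeasure a b ((fun x => (x, y)) ⁻¹' {p | t < (p.1 + p.2) ^ 2 / (p.1 - p.2) ^ 2}) :=
    measurable_measure_prodMk_right hA
  rw [Measure.prod_apply_symm hA]
  conv_lhs => rw [show ∀ f : ℝ → ENNReal, ∫⁻ y, f y ∂(gammaMeasure a b) =
    ∫⁻ y, f y ∂(volume.withDensity (gammaPDF a b)) from fun _ => rfl]
  rw [lintegral_withDensity_eq_lintegral_mul _ hm hinner]
  calc _ = ∫⁻ y, ∫⁻ r in Ioo ((√t - 1) / (√t + 1)) ((√t + 1) / (√t - 1)),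
        gammaPDF a b y * (ENNReal.ofReal y * gammaPDF a b (y * r)) := by
        refine lintegral_congr_ae ?_
        filter_upwards [hne] with y hy
        rw [Pi.mul_apply, preimage_ofPred_eq]
        rcases lt_or_gt_of_ne hy with hy | hy
        · simp [gammaPDF_of_neg hy]
        · rw [lintegral_const_mul _ (by fun_prop), lintegral_const_mul _ (by fun_prop),
            ← setLIntegral_gammaPDF_eq ht hy, gammaMeasure, withDensity_apply _ (hslice y)]
    _ = ∫⁻ r in Ioo ((√t - 1) / (√t + 1)) ((√t + 1) / (√t - 1)), ∫⁻ y,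
        gammaPDF a b y * (ENNReal.ofReal y * gammaPDF a b (y * r)) := by
        refine lintegral_lintegral_swap (Measurable.aemeasurable ?_)
        fun_prop
    _ = _ := by
        refine setLIntegral_congr_fun measurableSet_Ioo fun r hr => ?_
        have hr0 : 0 < r := lt_trans (by positivity) hr.1
        have h1r : 0 < b * (1 + r) := by positivity
        calc _ = ∫⁻ y, ENNReal.ofReal
              (Real.Gamma (2 * a) / Real.Gamma a ^ 2 * ratioKernel a r) *
                gammaPDF (2 * a) (b * (1 + r)) y := by
              refine lintegral_congr_ae ?_
              filter_upwards [hne] with y hy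
              rcases lt_or_gt_of_ne hy with hy | hy
              · simp [gammaPDF_of_neg hy]
              · have hK : 0 ≤ Real.Gamma (2 * a) / Real.Gamma a ^ 2 * ratioKernel a r := by
                  have := Real.Gamma_pos_of_pos (show 0 < 2 * a by linarith)
                  unfold ratioKernel
                  positivity
                simp only [gammaPDF]
                rw [← ENNReal.ofReal_mul hy.le,
                  ← ENNReal.ofReal_mul (gammaPDFReal_nonneg ha hb y), ← ENNReal.ofReal_mul hK,
                  gammaPDFReal_mul_gammaPDFReal ha hb hr0 hy]
          _ = _ := by
              rw [lintegral_const_mul (f := gammaPDF (2 * a) (b * (1 + r))) _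
                (measurable_gammaPDFReal _ _).ennreal_ofReal, lintegral_gammaPDF_eq_one (by linarith) h1r, mul_one]

lemma alphaHat_two (x : Fin 2 → ℝ) : alphaHat x = (x 0 + x 1) ^ 2 / (x 0 - x 1) ^ 2 := by
  have h : sampleVar x = (x 0 - x 1) ^ 2 / 4 := by
    simp only [sampleVar, sampleMean, Fin.sum_univ_two]
    push_cast
    ring
  rw [alphaHat, h, sampleMean, Fin.sum_univ_two, div_pow]
  norm_num
  rw [div_div_div_cancel_right₀ (by norm_num)]

/-! ### Density of the moment estimator. -/

lemma continuousOn_ratioKernel (a : ℝ) : ContinuousOn (ratioKernel a) (Ioi 0) := by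
  intro r hr
  have hr : 0 < r := hr
  have h1 : ContinuousAt (fun r : ℝ => r ^ (a - 1)) r :=
    Real.continuousAt_rpow_const _ _ (Or.inl hr.ne')
  have h2 : ContinuousAt (fun r : ℝ => (1 + r) ^ (-(2 * a))) r :=
    (continuousAt_const.add continuousAt_id).rpow_const (Or.inl (by simp; linarith))
  exact (h1.mul h2).continuousWithinAt

/-- This reflects that `r` and `1 / r` have the same law. -/
lemma ratioKernel_inv {a r : ℝ} (hr : 0 < r) : ratioKernel a r⁻¹ = r ^ 2 * ratioKernel a r := by
  have h1r : 0 < 1 + r := by linarith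
  have : 1 + r⁻¹ = (1 + r) * r⁻¹ := by field_simp; ring
  rw [ratioKernel, ratioKernel, this, Real.mul_rpow h1r.le (inv_pos.2 hr).le,
    Real.inv_rpow hr.le, Real.inv_rpow hr.le, ← Real.rpow_neg hr.le, ← Real.rpow_neg hr.le,
    ← Real.rpow_natCast r 2]
  have e : r ^ (-(a - 1)) * r ^ (-(-(2 * a))) = r ^ ((2 : ℕ) : ℝ) * r ^ (a - 1) := by
    rw [← Real.rpow_add hr, ← Real.rpow_add hr]
    congr 1
    push_cast
    ring
  linear_combination (1 + r) ^ (-(2 * a)) * e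

/-- The density of the moment estimator, in terms of the density of the ratio. -/
lemma ratioKernel_mul_eq {a s : ℝ} (hs : 1 < s) :
    ratioKernel a ((s - 1) / (s + 1)) * (s * (s + 1) ^ 2)⁻¹ =
      (2 : ℝ) ^ (-(2 * a)) * ((1 - 1 / s ^ 2) ^ (a - 1) * (s ^ 2) ^ (-(3 / 2) : ℝ)) := by
  have h0 : 0 < s := by linarith
  have h1 : 0 < s - 1 := by linarith
  have h2 : 0 < s + 1 := by linarith
  have e1 : 1 + (s - 1) / (s + 1) = 2 * s / (s + 1) := by field_simp; ring
  have e2 : 1 - 1 / s ^ 2 = (s - 1) * (s + 1) / s ^ 2 := by field_simp; ring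
  rw [ratioKernel, e1, e2]
  have hpos : 0 < (s - 1) * (s + 1) / s ^ 2 := by positivity
  -- Both sides are positive, so it suffices to compare logarithms, which turns the identity into a
  -- linear one.
  refine Real.log_injOn_pos (mem_Ioi.2 (by positivity)) (mem_Ioi.2 (by positivity)) ?_
  have q1 : 0 < ((s - 1) / (s + 1)) ^ (a - 1) := by positivity
  have q2 : 0 < (2 * s / (s + 1)) ^ (-(2 * a)) := by positivity
  have q3 : 0 < (2 : ℝ) ^ (-(2 * a)) := by positivity
  have q4 : 0 < ((s - 1) * (s + 1) / s ^ 2) ^ (a - 1) := by positivity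
  have q5 : 0 < (s ^ 2) ^ (-(3 / 2) : ℝ) := by positivity
  rw [Real.log_mul (by positivity) (by positivity), Real.log_mul q1.ne' q2.ne',
    Real.log_mul q3.ne' (by positivity), Real.log_mul q4.ne' q5.ne', Real.log_inv,
    Real.log_rpow (by positivity), Real.log_rpow (by positivity), Real.log_rpow (by positivity),
    Real.log_rpow (by positivity), Real.log_rpow (by positivity),
    Real.log_div h1.ne' h2.ne', Real.log_div (by positivity) h2.ne',
    Real.log_div (by positivity) (by positivity), Real.log_mul h1.ne' h2.ne',
    Real.log_mul two_ne_zero h0.ne', Real.log_mul h0.ne' (by positivity), Real.log_pow,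
    Real.log_pow]
  push_cast
  ring

lemma hasDerivAt_integral_ratioKernel {a t : ℝ} (ht : 1 < t) :
    HasDerivAt (fun t => ∫ r in ((√t - 1) / (√t + 1))..((√t + 1) / (√t - 1)), ratioKernel a r)
      (-(2 * (2 : ℝ) ^ (-(2 * a)) * ((1 - 1 / t) ^ (a - 1) * t ^ (-(3 / 2) : ℝ)))) t := by
  have hs : 1 < √t := by rw [Real.lt_sqrt zero_le_one]; simpa using ht
  have hst : √t ^ 2 = t := Real.sq_sqrt (by linarith)
  have hd : HasDerivAt (fun t => √t) (1 / (2 * √t)) t := Real.hasDerivAt_sqrt (by linarith)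
  have h1 : 0 < √t - 1 := by linarith
  have h2 : 0 < √t + 1 := by linarith
  have h0 : 0 < √t := by linarith
  have hlo : 0 < (√t - 1) / (√t + 1) := by positivity
  have hhi : 0 < (√t + 1) / (√t - 1) := by positivity
  have dlo : HasDerivAt (fun t => (√t - 1) / (√t + 1)) ((√t * (√t + 1) ^ 2)⁻¹) t := by
    refine ((hd.sub_const 1).div (hd.add_const 1) h2.ne').congr_deriv ?_
    field_simp
    ring
  have dhi : HasDerivAt (fun t => (√t + 1) / (√t - 1)) (-(√t * (√t - 1) ^ 2)⁻¹) t := by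
    refine ((hd.add_const 1).div (hd.sub_const 1) h1.ne').congr_deriv ?_
    field_simp
    ring
  have hcont : ∀ r > 0, ContinuousAt (ratioKernel a) r := fun r hr =>
    (continuousOn_ratioKernel a).continuousAt (Ioi_mem_nhds hr)
  have hmeas : ∀ r > 0, StronglyMeasurableAtFilter (ratioKernel a) (𝓝 r) := fun r hr =>
    (continuousOn_ratioKernel a).stronglyMeasurableAtFilter isOpen_Ioi r hr
  have hint : ∀ u > 0, ∀ v > 0, IntervalIntegrable (ratioKernel a) volume u v := by
    intro u hu v hv
    refine ((continuousOn_ratioKernel a).mono fun r hr => ?_).intervalIntegrable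
    exact lt_of_lt_of_le (lt_min hu hv) hr.1
  have e : (fun t => ∫ r in ((√t - 1) / (√t + 1))..((√t + 1) / (√t - 1)), ratioKernel a r)
      =ᶠ[𝓝 t] fun t => (∫ r in (1 : ℝ)..((√t + 1) / (√t - 1)), ratioKernel a r) -
        ∫ r in (1 : ℝ)..((√t - 1) / (√t + 1)), ratioKernel a r := by
    filter_upwards [lt_mem_nhds ht] with u hu
    have hs : 1 < √u := by rw [Real.lt_sqrt zero_le_one]; simpa using hu
    have h1 : 0 < √u - 1 := by linarith
    rw [intervalIntegral.integral_interval_sub_left]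
    · exact hint _ one_pos _ (by positivity)
    · exact hint _ one_pos _ (by positivity)
  refine HasDerivAt.congr_of_eventuallyEq ?_ e
  have ihi := (intervalIntegral.integral_hasDerivAt_right (hint 1 one_pos _ hhi) (hmeas _ hhi)
    (hcont _ hhi)).comp t dhi
  have ilo := (intervalIntegral.integral_hasDerivAt_right (hint 1 one_pos _ hlo) (hmeas _ hlo)
    (hcont _ hlo)).comp t dlo
  refine (ihi.sub ilo).congr_deriv ?_
  have hk := ratioKernel_mul_eq (a := a) hs
  rw [hst] at hk
  -- The endpoints are mutually inverse, so by symmetry they contribute equally; hence the factor 2.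
  rw [mul_assoc, ← hk, ← inv_div (√t - 1) (√t + 1), ratioKernel_inv hlo]
  field_simp
  ring

/-! ### Distribution function of the estimator from a sample. -/

namespace IsGammaSample

variable {Ω : Type*} [MeasurableSpace Ω] {P : Measure Ω}
  {X : Fin 2 → Ω → ℝ} {a l : ℝ}

lemma aemeasurable_alphaHat (hX : IsGammaSample X a l P) :
    AEMeasurable (fun ω => alphaHat (fun i => X i ω)) P := by
  have h0 := (hX.law 0).aemeasurable
  have h1 := (hX.law 1).aemeasurable
  simp only [alphaHat_two]
  fun_prop

lemma map_alphaHat_Ioi [IsProbabilityMeasure P] (hX : IsGammaSample X a l P) (t : ℝ) :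
    P.map (fun ω => alphaHat (fun i => X i ω)) (Ioi t) =
      (gammaMeasure a l⁻¹).prod (gammaMeasure a l⁻¹)
        {p | t < (p.1 + p.2) ^ 2 / (p.1 - p.2) ^ 2} := by
  have h0 := (hX.law 0).aemeasurable
  have h1 := (hX.law 1).aemeasurable
  have hA : MeasurableSet {p : ℝ × ℝ | t < (p.1 + p.2) ^ 2 / (p.1 - p.2) ^ 2} :=
    measurableSet_lt measurable_const (by fun_prop)
  have hind := (indepFun_iff_map_prod_eq_prod_map_map h0 h1).1
    (hX.indep.indepFun (show (0 : Fin 2) ≠ 1 by decide))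
  rw [(hX.law 0).map_eq, (hX.law 1).map_eq] at hind
  rw [← hind, Measure.map_apply_of_aemeasurable (h0.prodMk h1) hA,
    Measure.map_apply_of_aemeasurable hX.aemeasurable_alphaHat measurableSet_Ioi]
  simp only [alphaHat_two, preimage_ofPred_eq]
  rfl

end IsGammaSample

lemma ae_gammaMeasure_pos (a b : ℝ) : ∀ᵐ x ∂(gammaMeasure a b), 0 < x := by
  rw [ae_iff, gammaMeasure]
  simp only [not_lt]
  rw [show {x : ℝ | x ≤ 0} = Iic 0 from rfl, withDensity_apply _ measurableSet_Iic,
    setLIntegral_congr Iio_ae_eq_Iic.symm, lintegral_gammaPDF_of_nonpos le_rfl]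

/-- Off the null diagonal, `(x + y) ^ 2 - (x - y) ^ 2 = 4 * x * y > 0`. -/
lemma ae_prod_gammaMeasure_one_lt {a b : ℝ} (ha : 0 < a) (hb : 0 < b) :
    ∀ᵐ p ∂(gammaMeasure a b).prod (gammaMeasure a b), 1 < (p.1 + p.2) ^ 2 / (p.1 - p.2) ^ 2 := by
  have := isProbabilityMeasure_gammaMeasure ha hb
  have hne : ∀ᵐ p ∂(gammaMeasure a b).prod (gammaMeasure a b), p.1 ≠ p.2 := by
    have hdiag : MeasurableSet {p : ℝ × ℝ | p.1 = p.2} :=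
      measurableSet_eq_fun measurable_fst measurable_snd
    have h0 : ∀ y, gammaMeasure a b {x | x = y} = 0 := fun y =>
      withDensity_absolutelyContinuous _ _ (by simp)
    rw [ae_iff]
    simp only [ne_eq, not_not]
    rw [Measure.prod_apply_symm hdiag]
    simp only [preimage_ofPred_eq, h0, lintegral_zero]
  have h1 : ∀ᵐ p ∂(gammaMeasure a b).prod (gammaMeasure a b), 0 < p.1 :=
    Measure.quasiMeasurePreserving_fst.ae (ae_gammaMeasure_pos a b)
  have h2 : ∀ᵐ p ∂(gammaMeasure a b).prod (gammaMeasure a b), 0 < p.2 :=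
    Measure.quasiMeasurePreserving_snd.ae (ae_gammaMeasure_pos a b)
  filter_upwards [hne, h1, h2] with p hp hp1 hp2
  rw [one_lt_div (sq_pos_of_ne_zero (sub_ne_zero.2 hp))]
  nlinarith [mul_pos hp1 hp2]

namespace IsGammaSample

variable {Ω : Type*} [MeasurableSpace Ω] {P : Measure Ω} [IsProbabilityMeasure P]
  {X : Fin 2 → Ω → ℝ} {a l : ℝ}

lemma cdf_map_alphaHat (hX : IsGammaSample X a l P) (t : ℝ) :
    cdf (P.map (fun ω => alphaHat (fun i => X i ω))) t =
      1 - ((gammaMeasure a l⁻¹).prod (gammaMeasure a l⁻¹)).real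
        {p | t < (p.1 + p.2) ^ 2 / (p.1 - p.2) ^ 2} := by
  have := Measure.isProbabilityMeasure_map (μ := P) hX.aemeasurable_alphaHat
  rw [cdf_eq_real, ← compl_Ioi, probReal_compl_eq_one_sub measurableSet_Ioi, measureReal_def,
    hX.map_alphaHat_Ioi, measureReal_def]

lemma cdf_map_alphaHat_of_le_one (hX : IsGammaSample X a l P) (ha : 0 < a) (hl : 0 < l) {t : ℝ}
    (ht : t ≤ 1) : cdf (P.map (fun ω => alphaHat (fun i => X i ω))) t = 0 := by
  have := isProbabilityMeasure_gammaMeasure ha (inv_pos.2 hl)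
  have h : ((gammaMeasure a l⁻¹).prod (gammaMeasure a l⁻¹)).real
      {p | t < (p.1 + p.2) ^ 2 / (p.1 - p.2) ^ 2} = 1 := by
    rw [← probReal_univ (μ := (gammaMeasure a l⁻¹).prod (gammaMeasure a l⁻¹))]
    refine measureReal_congr ?_
    filter_upwards [ae_prod_gammaMeasure_one_lt ha (inv_pos.2 hl)] with p hp
    exact propext ⟨fun _ => trivial, fun _ => ht.trans_lt hp⟩
  rw [hX.cdf_map_alphaHat, h, sub_self]

lemma cdf_map_alphaHat_of_one_lt (hX : IsGammaSample X a l P) (ha : 0 < a) (hl : 0 < l) {t : ℝ}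
    (ht : 1 < t) : cdf (P.map (fun ω => alphaHat (fun i => X i ω))) t =
      1 - Real.Gamma (2 * a) / Real.Gamma a ^ 2 *
        ∫ r in ((√t - 1) / (√t + 1))..((√t + 1) / (√t - 1)), ratioKernel a r := by
  have hs : 1 < √t := by rw [Real.lt_sqrt zero_le_one]; simpa using ht
  have h1 : 0 < √t - 1 := by linarith
  have hle : (√t - 1) / (√t + 1) ≤ (√t + 1) / (√t - 1) := by
    rw [div_le_div_iff₀ (by linarith) h1]; nlinarith
  have hG := Real.Gamma_pos_of_pos (show 0 < 2 * a by linarith)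
  rw [hX.cdf_map_alphaHat, measureReal_def, prod_gammaMeasure_setOf_lt ha (inv_pos.2 hl) ht,
    intervalIntegral.integral_of_le hle, ← integral_Ioc_eq_integral_Ioo.symm,
    ← integral_const_mul, integral_eq_lintegral_of_nonneg_ae]
  · filter_upwards [ae_restrict_mem measurableSet_Ioo] with r hr
    have hr0 : 0 < r := lt_trans (by positivity) hr.1
    unfold ratioKernel
    simp only [Pi.zero_apply]
    positivity
  · refine ContinuousOn.aestronglyMeasurable ?_ measurableSet_Ioo
    refine ((continuousOn_ratioKernel a).mono fun r hr => ?_).const_mul _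
    exact lt_trans (by positivity) hr.1

lemma hasMomentCdf (hX : IsGammaSample X a l P) (ha : 0 < a) (hl : 0 < l) :
    HasMomentCdf (cdf (P.map (fun ω => alphaHat (fun i => X i ω)))) a := by
  have hz : ∀ x ≤ 1, cdf (P.map (fun ω => alphaHat (fun i => X i ω))) x = 0 := fun x hx =>
    hX.cdf_map_alphaHat_of_le_one ha hl hx
  have hG := Real.Gamma_pos_of_pos (show 0 < 2 * a by linarith)
  have hG' := Real.Gamma_pos_of_pos ha
  have hd : ∃ c > 0, ∀ x > 1, HasDerivAt (cdf (P.map (fun ω => alphaHat (fun i => X i ω))))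
      (c * (1 - 1 / x) ^ (a - 1) * x ^ (-(3 / 2) : ℝ)) x := by
    refine ⟨Real.Gamma (2 * a) / Real.Gamma a ^ 2 * (2 * (2 : ℝ) ^ (-(2 * a))), by positivity,
      fun x hx => ?_⟩
    have h := ((hasDerivAt_integral_ratioKernel (a := a) hx).const_mul
      (Real.Gamma (2 * a) / Real.Gamma a ^ 2)).const_sub 1
    refine (h.congr_of_eventuallyEq ?_).congr_deriv (by ring)
    filter_upwards [lt_mem_nhds hx] with t ht
    exact hX.cdf_map_alphaHat_of_one_lt ha hl ht
  refine ⟨continuous_iff_continuousAt.2 fun x => ?_, hz, tendsto_cdf_atTop _, hd⟩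
  rcases lt_trichotomy x 1 with hx | rfl | hx
  · refine continuousAt_const.congr (f := fun _ => (0 : ℝ)) ?_
    filter_upwards [gt_mem_nhds hx] with y hy
    exact (hz y hy.le).symm
  -- The derivative formula stops short of 1, where the density is unbounded if `a < 1`. Right
  -- continuity holds for any distribution function, and on the left the function vanishes.
  · refine continuousAt_iff_continuous_left_right.2
      ⟨?_, StieltjesFunction.right_continuous _ 1⟩
    exact continuousWithinAt_const.congr (fun y hy => hz y hy) (hz 1 le_rfl)
  · obtain ⟨c, -, hc⟩ := hd
    exact (hc x hx).continuousAt

end IsGammaSample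

end GammaMoment

theorem proposition3 {Ω₁ Ω₂ : Type*} [MeasurableSpace Ω₁] [MeasurableSpace Ω₂]
    (P₁ : Measure Ω₁) [IsProbabilityMeasure P₁] (P₂ : Measure Ω₂) [IsProbabilityMeasure P₂]
    (α₁ α₂ lam₁ lam₂ : ℝ) (hα₁ : 0 < α₁) (hα : α₁ < α₂) (hlam₁ : 0 < lam₁) (hlam₂ : 0 < lam₂)
    (X : Fin 2 → Ω₁ → ℝ) (Y : Fin 2 → Ω₂ → ℝ)
    (hX : GammaMoment.IsGammaSample X α₁ lam₁ P₁)
    (hY : GammaMoment.IsGammaSample Y α₂ lam₂ P₂) :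
    GammaMoment.StarLE
        (P₁.map (fun ω => GammaMoment.alphaHat (fun i => X i ω)))
        (P₂.map (fun ω => GammaMoment.alphaHat (fun i => Y i ω))) ∧
      GammaMoment.DispLE
        (P₁.map (fun ω => Real.log (GammaMoment.alphaHat (fun i => X i ω))))
        (P₂.map (fun ω => Real.log (GammaMoment.alphaHat (fun i => Y i ω)))) := by
  have hmX := hX.aemeasurable_alphaHat
  have hmY := hY.aemeasurable_alphaHat
  have := Measure.isProbabilityMeasure_map (μ := P₁) hmX
  have := Measure.isProbabilityMeasure_map (μ := P₂) hmY
  have hF := hX.hasMomentCdf hα₁ hlam₁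
  have hG := hY.hasMomentCdf (hα₁.trans hα) hlam₂
  refine ⟨GammaMoment.starLE_of_hasMomentCdf hF hG hα, ?_⟩
  have h := GammaMoment.dispLE_map_log_of_hasMomentCdf hF hG hα
  rwa [AEMeasurable.map_map_of_aemeasurable Real.measurable_log.aemeasurable hmX,
    AEMeasurable.map_map_of_aemeasurable Real.measurable_log.aemeasurable hmY] at h
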